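/- All graphs are finite, simple and undirected. Let $G$ be a graph and $S\subseteq V(G)$ with $|S|\ge 2$. A pendant $S$-Steiner tree of $G$ is a subgraph $T$ of $G$ that is a tree with $S\subseteq V(T)$ and in which every vertex of $S$ has degree $1$. Two such trees $T,T'$ are edge-disjoint if $E(T)\cap E(T')=\varnothing$, and internally disjoint if $E(T)\cap E(T')=\varnothing$ and $V(T)\cap V(T')=S$. Let $\tau_G(S)$ (resp. $\mu_G(S)$) be the maximum number of pairwise internally disjoint (resp. pairwise edge-disjoint) pendant $S$-Steiner trees in $G$, and put $$\tau_3(G)=\min\{\tau_G(S) : S\subseteq V(G),\ |S|=3\},\qquad \mu_3(G)=\min\{\mu_G(S) : S\subseteq V(G),\ |S|=3\},$$ with the convention $\tau_3(G)=\mu_3(G)=0$ if $G$ has fewer than three vertices. Let $L(G)$ denote the line graph of $G$. Theorem. Let $G$ be a connected graph. Then 1. $\mu_3(G)\le \tau_3(L(G))$; 2. $\mu_3(L(G))\ge \frac{1}{12}\mu_3(G)-\frac12$; 3. $\tau_3(L(L(G)))\ge \frac14\tau_3(G)-\frac23$. -/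

import Mathlib

namespace SimpleGraph

variable {V : Type*} {G : SimpleGraph V}

/-- `T` is a pendant `S`-Steiner tree of `G`: a subgraph of `G` that is a tree, contains all
vertices of `S`, and in which every vertex of `S` has degree one. -/
structure IsPendantSteinerTree (S : Finset V) (T : G.Subgraph) : Prop where
  isTree : T.coe.IsTree
  subset_verts : (S : Set V) ⊆ T.verts
  degree_eq_one : ∀ v ∈ S, (T.neighborSet v).ncard = 1

/-- Two subgraphs are internally disjoint with respect to `S` if they share no edge and share
exactly the vertices of `S`. -/
def InternallyDisjoint (S : Finset V) (T T' : G.Subgraph) : Prop :=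
  T.edgeSet ∩ T'.edgeSet = ∅ ∧ T.verts ∩ T'.verts = (S : Set V)

/-- Two subgraphs are edge-disjoint if they share no edge. -/
def EdgeDisjoint (T T' : G.Subgraph) : Prop :=
  T.edgeSet ∩ T'.edgeSet = ∅

/-- The pendant-tree local connectivity `τ_G(S)`: the maximum number of pairwise internally
disjoint pendant `S`-Steiner trees in `G` (for finite `G` the supremum is a maximum). -/
noncomputable def pendantTreeLocalConnectivity (G : SimpleGraph V) (S : Finset V) : ℕ :=
  sSup {m | ∃ F : Finset G.Subgraph, F.card = m ∧ (∀ T ∈ F, IsPendantSteinerTree S T) ∧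
    (F : Set G.Subgraph).Pairwise (InternallyDisjoint S)}

/-- The pendant-tree local edge-connectivity `μ_G(S)`: the maximum number of pairwise edge-disjoint
pendant `S`-Steiner trees in `G` (for finite `G` the supremum is a maximum). -/
noncomputable def pendantTreeLocalEdgeConnectivity (G : SimpleGraph V) (S : Finset V) : ℕ :=
  sSup {m | ∃ F : Finset G.Subgraph, F.card = m ∧ (∀ T ∈ F, IsPendantSteinerTree S T) ∧
    (F : Set G.Subgraph).Pairwise EdgeDisjoint}

/-- The pendant-tree `k`-connectivity `τ_k(G)`: the minimum of `τ_G(S)` over all `k`-element vertex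
sets `S`. If `G` has fewer than `k` vertices, the value is `0`. -/
noncomputable def pendantTreeConnectivity (G : SimpleGraph V) (k : ℕ) : ℕ :=
  sInf {m | ∃ S : Finset V, S.card = k ∧ G.pendantTreeLocalConnectivity S = m}

/-- The pendant-tree `k`-edge-connectivity `μ_k(G)`: the minimum of `μ_G(S)` over all `k`-element
vertex sets `S`. If `G` has fewer than `k` vertices, the value is `0`. -/
noncomputable def pendantTreeEdgeConnectivity (G : SimpleGraph V) (k : ℕ) : ℕ :=
  sInf {m | ∃ S : Finset V, S.card = k ∧ G.pendantTreeLocalEdgeConnectivity S = m}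

end SimpleGraph

namespace SimpleGraph

/-! ### Building and counting pendant trees from connected sets. -/

section LocalConnectivity

variable {V : Type*} {G : SimpleGraph V}

/-! A pendant `S`-Steiner tree with no edge inside `S` amounts to a connected vertex set off `S`
that is adjacent to every vertex of `S`. So, for three edges `e i` of `G`, it suffices to find
disjoint connected sets of other edges, each touching every `e i`
(`card_le_pendantTreeLocalConnectivity`). Pick distinct endpoints `x i` of the `e i`. A pendant tree
on the `x i`, with any `e i` it contains deleted, gives such an edge set: its vertices off the `x i`
stay connected because the `x i` are leaves, and edge-disjoint trees give disjoint sets. The one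
obstruction is that every `e i` is `s(x i, y)` for a common `y`, when the tree may be the claw
itself and nothing remains; `exists_representatives` chooses endpoints that avoid this. Parts 2 and
3 then hold with constant 1 and no error term: τ₃ ≤ μ₃ is combined with part 1, applied to `G` and
to its line graph. -/

lemma bddAbove_card_of_finite [Finite V] (P : Finset G.Subgraph → Prop) :
    BddAbove {m | ∃ F : Finset G.Subgraph, F.card = m ∧ P F} := by
  classical
  have : Fintype G.Subgraph := Fintype.ofFinite _
  refine ⟨Fintype.card G.Subgraph, ?_⟩
  rintro m ⟨F, rfl, -⟩
  exact F.card_le_univ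

lemma pendantTreeLocalConnectivity_le_edge [Finite V] (S : Finset V) :
    G.pendantTreeLocalConnectivity S ≤ G.pendantTreeLocalEdgeConnectivity S := by
  refine csSup_le_csSup (bddAbove_card_of_finite _) ⟨0, ∅, by simp⟩ ?_
  rintro m ⟨F, hF, hT, hd⟩
  exact ⟨F, hF, hT, fun T h T' h' hne => (hd h h' hne).1⟩

lemma pendantTreeConnectivity_le_edge [Finite V] (k : ℕ) :
    G.pendantTreeConnectivity k ≤ G.pendantTreeEdgeConnectivity k := by
  by_cases h : ∃ S : Finset V, S.card = k
  · have hne : {m | ∃ S : Finset V, S.card = k ∧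
        G.pendantTreeLocalEdgeConnectivity S = m}.Nonempty :=
      let ⟨S, hS⟩ := h; ⟨_, S, hS, rfl⟩
    obtain ⟨S, hS, hm⟩ := Nat.sInf_mem hne
    rw [pendantTreeEdgeConnectivity, ← hm]
    refine le_trans (Nat.sInf_le ?_) (pendantTreeLocalConnectivity_le_edge S)
    exact ⟨S, hS, rfl⟩
  · have : {m | ∃ S : Finset V, S.card = k ∧
        G.pendantTreeLocalConnectivity S = m} = ∅ := by
      ext m
      simp only [Set.mem_ofPred_eq, Set.mem_empty_iff_false, iff_false]
      rintro ⟨S, hS, -⟩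
      exact h ⟨S, hS⟩
    simp [pendantTreeConnectivity, this]

/-- A connected vertex set `A` disjoint from `S` in which every vertex of `S` has a neighbour
extends to a pendant `S`-Steiner tree on `A ∪ S` without edges inside `S`. -/
lemma exists_isPendantSteinerTree {S : Finset V} {A : Set V} (hA : (G.induce A).Connected)
    (hdisj : ∀ a ∈ A, a ∉ S) (hS : ∀ s ∈ S, ∃ a ∈ A, G.Adj s a) :
    ∃ T : G.Subgraph, IsPendantSteinerTree S T ∧ T.verts = A ∪ S ∧
      ∀ u v, T.Adj u v → u ∈ A ∨ v ∈ A := by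
  classical
  choose! c hcA hc using hS
  let W : Set V := A ∪ S
  -- Each `s ∈ S` keeps a single edge, to `c s`, so it is a leaf of `K` and of any spanning tree of
  -- `K`.
  let K : SimpleGraph W :=
    { Adj := fun u v => G.Adj u v ∧ ((u.1 ∈ A ∧ v.1 ∈ A) ∨
        (u.1 ∈ S ∧ v.1 = c u) ∨ (v.1 ∈ S ∧ u.1 = c v))
      symm := ⟨fun u v h => ⟨h.1.symm, by tauto⟩⟩
      loopless := ⟨fun u h => G.irrefl h.1⟩ }
  obtain ⟨a₀⟩ := hA.nonempty
  have hAW : ∀ a ∈ A, a ∈ W := fun a h => Or.inl h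
  let φ : G.induce A →g K :=
    { toFun := fun a => ⟨a.1, hAW a.1 a.2⟩
      map_rel' := fun {a b} h => ⟨h, Or.inl ⟨a.2, b.2⟩⟩ }
  have hreach : ∀ w : W, K.Reachable (φ a₀) w := by
    rintro ⟨w, hw⟩
    have hwA : ∀ a (h : a ∈ A), K.Reachable (φ a₀) ⟨a, hAW a h⟩ := fun a h =>
      (hA.preconnected a₀ ⟨a, h⟩).map φ
    rcases hw with h | h
    · exact hwA w h
    · refine (hwA (c w) (hcA w h)).trans (Adj.reachable ?_)
      exact ⟨(hc w h).symm, Or.inr (Or.inr ⟨h, rfl⟩)⟩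
  have hK : K.Connected :=
    { preconnected := fun u v => (hreach u).symm.trans (hreach v)
      nonempty := ⟨φ a₀⟩ }
  obtain ⟨T, hTK, hT⟩ := hK.exists_isTree_le
  let T' : G.Subgraph :=
    { verts := W
      Adj := fun u v => ∃ (hu : u ∈ W) (hv : v ∈ W), T.Adj ⟨u, hu⟩ ⟨v, hv⟩
      adj_sub := fun ⟨_, _, h⟩ => (hTK h).1
      edge_vert := fun ⟨h, _, _⟩ => h
      symm := ⟨fun _ _ ⟨hu, hv, h⟩ => ⟨hv, hu, h.symm⟩⟩ }
  have hcoe : T'.coe = T := by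
    ext u v
    constructor
    · rintro ⟨_, _, h⟩
      exact h
    · intro h
      exact ⟨u.2, v.2, h⟩
  have hT' : T'.coe.IsTree := by
    rw [hcoe]
    exact hT
  refine ⟨T', ⟨hT', fun s hs => Or.inr hs, fun s hs => ?_⟩, rfl, ?_⟩
  · have hsW : s ∈ W := Or.inr hs
    have hnbr : ∀ v, T'.Adj s v → v = c s := by
      rintro v ⟨_, _, h⟩
      rcases (hTK h).2 with h | h | h
      · exact absurd hs (hdisj _ h.1)
      · exact h.2
      · exact absurd hs (hdisj s (Set.mem_of_eq_of_mem h.2 (hcA _ h.1)))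
    have hne : (⟨s, hsW⟩ : W) ≠ φ a₀ := fun h =>
      hdisj _ a₀.2 ((congrArg Subtype.val h : s = a₀.1) ▸ hs)
    obtain ⟨w, hw⟩ : ∃ w, T.Adj ⟨s, hsW⟩ w := by
      obtain ⟨p⟩ := hT.1.preconnected ⟨s, hsW⟩ (φ a₀)
      cases p with
      | nil => exact absurd rfl hne
      | cons h _ => exact ⟨_, h⟩
    have hw' : T'.Adj s w := ⟨hsW, w.2, hw⟩
    rw [Set.ncard_eq_one]
    refine ⟨c s, Set.eq_singleton_iff_unique_mem.2 ⟨?_, hnbr⟩⟩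
    rw [← hnbr w hw']
    exact hw'
  · rintro u v ⟨_, _, h⟩
    rcases (hTK h).2 with h | h | h
    · exact Or.inl h.1
    · exact Or.inr (Set.mem_of_eq_of_mem h.2 (hcA _ h.1))
    · exact Or.inl (Set.mem_of_eq_of_mem h.2 (hcA _ h.1))

/-- Disjoint connected vertex sets avoiding `S`, each adjacent to every vertex of `S`, bound
`τ_G(S)` from below. -/
lemma card_le_pendantTreeLocalConnectivity [Finite V] {ι : Type*} [Fintype ι] {S : Finset V}
    (A : ι → Set V) (hpd : Pairwise fun i j => Disjoint (A i) (A j))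
    (hA : ∀ i, (G.induce (A i)).Connected) (hdisj : ∀ i, ∀ a ∈ A i, a ∉ S)
    (hS : ∀ i, ∀ s ∈ S, ∃ a ∈ A i, G.Adj s a) :
    Fintype.card ι ≤ G.pendantTreeLocalConnectivity S := by
  classical
  choose T hT hverts hadj using fun i => exists_isPendantSteinerTree (hA i) (hdisj i) (hS i)
  have hnot : ∀ i j, i ≠ j → ∀ v ∈ A i, v ∉ (T j).verts := by
    intro i j hij v hv hv'
    rw [hverts] at hv'
    rcases hv' with h | h
    · exact Set.disjoint_left.1 (hpd hij) hv h
    · exact hdisj i v hv h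
  have hinj : Function.Injective T := by
    intro i j h
    by_contra hij
    obtain ⟨a⟩ := (hA i).nonempty
    refine hnot i j hij a a.2 ?_
    rw [← h, hverts]
    exact Or.inl a.2
  refine le_csSup (bddAbove_card_of_finite _) ⟨Finset.univ.image T, ?_, ?_, ?_⟩
  · rw [Finset.card_image_of_injective _ hinj, Finset.card_univ]
  · intro T' hT'
    obtain ⟨i, -, rfl⟩ := Finset.mem_image.1 hT'
    exact hT i
  · intro T₁ h₁ T₂ h₂ hne
    obtain ⟨i, -, rfl⟩ := Finset.mem_image.1 h₁
    obtain ⟨j, -, rfl⟩ := Finset.mem_image.1 h₂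
    have hij : i ≠ j := fun h => hne (congrArg T h)
    constructor
    · refine Set.eq_empty_iff_forall_notMem.2 fun e => ?_
      induction e with
      | _ u v =>
        rintro ⟨hi, hj⟩
        rw [Subgraph.mem_edgeSet] at hi hj
        rcases hadj i u v hi with h | h
        · exact hnot i j hij u h hj.fst_mem
        · exact hnot i j hij v h hj.snd_mem
    · ext v
      constructor
      · rintro ⟨hi, hj⟩
        have hi' := hi
        rw [hverts] at hi'
        exact hi'.resolve_left fun h => hnot i j hij v h hj
      · intro h
        exact ⟨(hT i).subset_verts h, (hT j).subset_verts h⟩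

end LocalConnectivity

/-! ### Leaves and interior of a pendant Steiner tree. -/

namespace IsPendantSteinerTree

variable {V : Type*} {G : SimpleGraph V} {S : Finset V} {T : G.Subgraph}

lemma reflTransGen (hT : IsPendantSteinerTree S T) {u v : V} (hu : u ∈ T.verts)
    (hv : v ∈ T.verts) : Relation.ReflTransGen T.Adj u v := by
  have h := (reachable_iff_reflTransGen _ _).1 (hT.isTree.1.preconnected ⟨u, hu⟩ ⟨v, hv⟩)
  exact h.lift Subtype.val fun a b hab => hab

lemma exists_adj (hT : IsPendantSteinerTree S T) {s : V} (hs : s ∈ S) : ∃ y, T.Adj s y := by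
  obtain ⟨y, hy⟩ := Set.ncard_eq_one.1 (hT.degree_eq_one s hs)
  exact ⟨y, by rw [← Subgraph.mem_neighborSet, hy]; rfl⟩

lemma adj_unique (hT : IsPendantSteinerTree S T) {s y z : V} (hs : s ∈ S) (hy : T.Adj s y)
    (hz : T.Adj s z) : y = z := by
  obtain ⟨w, hw⟩ := Set.ncard_eq_one.1 (hT.degree_eq_one s hs)
  rw [← Subgraph.mem_neighborSet, hw] at hy hz
  exact hy.trans hz.symm

/-- Two adjacent leaves would form a whole component, leaving a third vertex of `S` unreachable. -/
lemma not_mem_of_adj (hT : IsPendantSteinerTree S T) (hS : 3 ≤ S.card) {s y : V} (hs : s ∈ S)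
    (hy : T.Adj s y) : y ∉ S := by
  classical
  intro hyS
  obtain ⟨z, hz, hzs⟩ : ∃ z ∈ S, z ∉ ({s, y} : Finset V) := by
    by_contra! h
    exact absurd ((Finset.card_le_card h).trans Finset.card_le_two) (by omega)
  have key : z = s ∨ z = y := by
    have h := hT.reflTransGen (hT.subset_verts hs) (hT.subset_verts hz)
    clear hzs hz
    induction h with
    | refl => exact Or.inl rfl
    | tail _ hab ih =>
      rcases ih with rfl | rfl
      · exact Or.inr (hT.adj_unique hs hab hy)
      · exact Or.inl (hT.adj_unique hyS hab hy.symm)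
  simp only [Finset.mem_insert, Finset.mem_singleton] at hzs
  exact hzs key

/-- The vertices of a pendant `S`-Steiner tree outside `S` are connected within the tree
through vertices outside `S`. -/
lemma reflTransGen_compl (hT : IsPendantSteinerTree S T) (hS : 3 ≤ S.card) {u v : V}
    (hu : u ∈ T.verts) (hv : v ∈ T.verts) (huS : u ∉ S) (hvS : v ∉ S) :
    Relation.ReflTransGen (fun a b => T.Adj a b ∧ a ∉ S ∧ b ∉ S) u v := by
  set R := Relation.ReflTransGen (fun a b => T.Adj a b ∧ a ∉ S ∧ b ∉ S) with hR
  -- Strengthened for induction: a path entering a leaf must leave through the same neighbour, so at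
  -- a leaf the claim is recorded for that neighbour.
  suffices h : (v ∉ S → R u v) ∧ (v ∈ S → ∀ y, T.Adj v y → R u y) from h.1 hvS
  have h := hT.reflTransGen hu hv
  clear hvS hv
  induction h with
  | refl => exact ⟨fun _ => .refl, fun h => absurd h huS⟩
  | @tail a b _ hab ih =>
    by_cases ha : a ∈ S
    · exact ⟨fun _ => ih.2 ha b hab, fun hb => absurd hb (hT.not_mem_of_adj hS ha hab)⟩
    · refine ⟨fun hb => (ih.1 ha).tail ⟨hab, ha, hb⟩, fun hb y hy => ?_⟩
      rw [hT.adj_unique hb hy hab.symm]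
      exact ih.1 ha

end IsPendantSteinerTree

/-! ### From trees in the graph to connected sets in its line graph. -/

section LineGraph

variable {V : Type*} {G : SimpleGraph V}

lemma lineGraph_adj_of_mem {e f : G.edgeSet} (hne : e ≠ f) {v : V} (he : v ∈ e.1)
    (hf : v ∈ f.1) : G.lineGraph.Adj e f :=
  ⟨hne, v, he, hf⟩

/-- Three distinct edges have distinct representatives whose opposite endpoints do not all
coincide. -/
lemma exists_representatives (e : Fin 3 → G.edgeSet) (he : Function.Injective e) :
    ∃ x : Fin 3 → V, Function.Injective x ∧ (∀ i, x i ∈ (e i).1) ∧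
      ¬ ∃ y, ∀ i, (e i).1 = s(x i, y) := by
  obtain ⟨a, b, h0⟩ : ∃ a b, s(a, b) = (e 0).1 :=
    Sym2.ind (fun u v => ⟨u, v, rfl⟩) (e 0).1
  obtain ⟨c, d, h1⟩ : ∃ c d, s(c, d) = (e 1).1 :=
    Sym2.ind (fun u v => ⟨u, v, rfl⟩) (e 1).1
  obtain ⟨p, q, h2⟩ : ∃ p q, s(p, q) = (e 2).1 :=
    Sym2.ind (fun u v => ⟨u, v, rfl⟩) (e 2).1
  have n0 : a ≠ b := G.ne_of_adj (by rw [← mem_edgeSet, h0]; exact (e 0).2)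
  have n1 : c ≠ d := G.ne_of_adj (by rw [← mem_edgeSet, h1]; exact (e 1).2)
  have n2 : p ≠ q := G.ne_of_adj (by rw [← mem_edgeSet, h2]; exact (e 2).2)
  have d01 : s(a, b) ≠ s(c, d) := fun h =>
    absurd (he (Subtype.ext (h0.symm.trans (h.trans h1)))) (by decide)
  have d02 : s(a, b) ≠ s(p, q) := fun h =>
    absurd (he (Subtype.ext (h0.symm.trans (h.trans h2)))) (by decide)
  have d12 : s(c, d) ≠ s(p, q) := fun h =>
    absurd (he (Subtype.ext (h1.symm.trans (h.trans h2)))) (by decide)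
  have key : ∀ x₀ y₀ x₁ y₁ x₂ y₂ : V, s(a, b) = s(x₀, y₀) → s(c, d) = s(x₁, y₁) →
      s(p, q) = s(x₂, y₂) → x₀ ≠ x₁ → x₀ ≠ x₂ → x₁ ≠ x₂ → ¬ (y₀ = y₁ ∧ y₁ = y₂) →
      ∃ x : Fin 3 → V, Function.Injective x ∧ (∀ i, x i ∈ (e i).1) ∧
        ¬ ∃ y, ∀ i, (e i).1 = s(x i, y) := by
    intro x₀ y₀ x₁ y₁ x₂ y₂ e0 e1 e2 n01 n02 n12 hy
    have h0' : (e 0).1 = s(x₀, y₀) := h0.symm.trans e0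
    have h1' : (e 1).1 = s(x₁, y₁) := h1.symm.trans e1
    have h2' : (e 2).1 = s(x₂, y₂) := h2.symm.trans e2
    refine ⟨![x₀, x₁, x₂], ?_, ?_, ?_⟩
    · intro i j
      fin_cases i <;> fin_cases j <;> simp [n01, n02, n12, n01.symm, n02.symm, n12.symm]
    · intro i
      fin_cases i <;> simp [h0', h1', h2']
    · rintro ⟨y, h⟩
      have g0 := h 0
      have g1 := h 1
      have g2 := h 2
      rw [h0'] at g0
      rw [h1'] at g1
      rw [h2'] at g2
      have g0 := Sym2.congr_right.1 g0
      have g1 := Sym2.congr_right.1 g1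
      have g2 := Sym2.congr_right.1 g2
      exact hy ⟨g0.trans g1.symm, g1.trans g2.symm⟩
  -- If all eight choices of endpoints failed, two of the edges would coincide or one would be a
  -- loop.
  by_contra hcon
  have k000 := fun h₁ h₂ h₃ h₄ => hcon (key a b c d p q rfl rfl rfl h₁ h₂ h₃ h₄)
  have k001 := fun h₁ h₂ h₃ h₄ => hcon (key a b c d q p rfl rfl Sym2.eq_swap h₁ h₂ h₃ h₄)
  have k010 := fun h₁ h₂ h₃ h₄ => hcon (key a b d c p q rfl Sym2.eq_swap rfl h₁ h₂ h₃ h₄)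
  have k011 := fun h₁ h₂ h₃ h₄ =>
    hcon (key a b d c q p rfl Sym2.eq_swap Sym2.eq_swap h₁ h₂ h₃ h₄)
  have k100 := fun h₁ h₂ h₃ h₄ => hcon (key b a c d p q Sym2.eq_swap rfl rfl h₁ h₂ h₃ h₄)
  have k101 := fun h₁ h₂ h₃ h₄ =>
    hcon (key b a c d q p Sym2.eq_swap rfl Sym2.eq_swap h₁ h₂ h₃ h₄)
  have k110 := fun h₁ h₂ h₃ h₄ =>
    hcon (key b a d c p q Sym2.eq_swap Sym2.eq_swap rfl h₁ h₂ h₃ h₄)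
  have k111 := fun h₁ h₂ h₃ h₄ =>
    hcon (key b a d c q p Sym2.eq_swap Sym2.eq_swap Sym2.eq_swap h₁ h₂ h₃ h₄)
  simp only [ne_eq, Sym2.eq_iff] at d01 d02 d12
  clear key hcon h0 h1 h2
  grind

variable {e : Fin 3 → G.edgeSet} {x : Fin 3 → V} {T : G.Subgraph}

/-- The edges of `T` other than the `e i`, as a set of vertices of the line graph. -/
def edgesAvoiding (T : G.Subgraph) (e : Fin 3 → G.edgeSet) : Set G.edgeSet :=
  {f | f.1 ∈ T.edgeSet ∧ ∀ i, f ≠ e i}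

/-- An edge of `G` joining two adjacent vertices of `T`, as a vertex of the line graph. -/
def edgeOfAdj {u v : V} (h : T.Adj u v) : G.edgeSet :=
  ⟨s(u, v), h.adj_sub⟩

lemma edgeOfAdj_mem_edgesAvoiding [DecidableEq V] (hxe : ∀ i, x i ∈ (e i).1) {u v : V}
    (h : T.Adj u v) (hu : u ∉ Finset.univ.image x) (hv : v ∉ Finset.univ.image x) :
    edgeOfAdj h ∈ edgesAvoiding T e := by
  refine ⟨h, fun i hi => ?_⟩
  have hm := hxe i
  rw [← hi] at hm
  rcases Sym2.mem_iff.1 hm with hm | hm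
  · exact hu (hm ▸ Finset.mem_image_of_mem x (Finset.mem_univ i))
  · exact hv (hm ▸ Finset.mem_image_of_mem x (Finset.mem_univ i))

lemma edgeOfAdj_pendant_mem_edgesAvoiding [DecidableEq V] (hx : Function.Injective x)
    (hxe : ∀ i, x i ∈ (e i).1) (hT : IsPendantSteinerTree (Finset.univ.image x) T) {i : Fin 3}
    {y : V} (h : T.Adj (x i) y) (hne : (e i).1 ≠ s(x i, y)) :
    edgeOfAdj h ∈ edgesAvoiding T e := by
  have hcard : 3 ≤ (Finset.univ.image x).card := by simp [Finset.card_image_of_injective _ hx]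
  have hmem : ∀ j, x j ∈ Finset.univ.image x := fun j =>
    Finset.mem_image_of_mem x (Finset.mem_univ j)
  refine ⟨h, fun j hj => ?_⟩
  have hm := hxe j
  rw [← hj] at hm
  rcases Sym2.mem_iff.1 hm with hm | hm
  · obtain rfl := hx hm
    exact hne (congrArg Subtype.val hj).symm
  · exact hT.not_mem_of_adj hcard (hmem i) h (hm ▸ hmem j)

/-- The pendant edge at `x i` serves unless it is `e i`. In that case its inner end `y` lies on `e
i`, and a surviving tree edge at `y` is found using an index `k` with `e k` different from `s(x k,
y)`. -/
lemma exists_mem_edgesAvoiding_adj [DecidableEq V] (hx : Function.Injective x)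
    (hxe : ∀ i, x i ∈ (e i).1) (hy : ¬ ∃ y, ∀ i, (e i).1 = s(x i, y))
    (hT : IsPendantSteinerTree (Finset.univ.image x) T) (i : Fin 3) :
    ∃ f ∈ edgesAvoiding T e, G.lineGraph.Adj (e i) f := by
  have hcard : 3 ≤ (Finset.univ.image x).card := by simp [Finset.card_image_of_injective _ hx]
  have hmem : ∀ j, x j ∈ Finset.univ.image x := fun j =>
    Finset.mem_image_of_mem x (Finset.mem_univ j)
  obtain ⟨y, hxy⟩ := hT.exists_adj (hmem i)
  by_cases hi : (e i).1 = s(x i, y)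
  swap
  · have hf := edgeOfAdj_pendant_mem_edgesAvoiding hx hxe hT hxy hi
    exact ⟨_, hf, lineGraph_adj_of_mem (hf.2 i).symm (hxe i) (Sym2.mem_mk_left _ _)⟩
  have hyS := hT.not_mem_of_adj hcard (hmem i) hxy
  have hye : y ∈ (e i).1 := hi ▸ Sym2.mem_mk_right _ _
  obtain ⟨k, hk⟩ : ∃ k, (e k).1 ≠ s(x k, y) := by
    by_contra! h
    exact hy ⟨y, h⟩
  obtain ⟨z, hz⟩ := hT.exists_adj (hmem k)
  -- Either the pendant edge at `x k` ends at `y`, or the interior path from `y` to `z` starts with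
  -- an edge at `y`.
  by_cases hzy : z = y
  · subst hzy
    have hf := edgeOfAdj_pendant_mem_edgesAvoiding hx hxe hT hz hk
    exact ⟨_, hf, lineGraph_adj_of_mem (hf.2 i).symm hye (Sym2.mem_mk_right _ _)⟩
  · have hzS := hT.not_mem_of_adj hcard (hmem k) hz
    rcases (hT.reflTransGen_compl hcard hxy.snd_mem hz.snd_mem hyS hzS).cases_head with h | h
    · exact absurd h.symm hzy
    · obtain ⟨w, ⟨hyw, -, hwS⟩, -⟩ := h
      have hf := edgeOfAdj_mem_edgesAvoiding hxe hyw hyS hwS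
      exact ⟨_, hf, lineGraph_adj_of_mem (hf.2 i).symm hye (Sym2.mem_mk_left _ _)⟩

lemma reachable_induce_of_mem {A : Set G.edgeSet} (f g : A) {v : V} (hf : v ∈ f.1.1)
    (hg : v ∈ g.1.1) : (G.lineGraph.induce A).Reachable f g := by
  by_cases h : f = g
  · exact h ▸ Reachable.rfl
  · exact Adj.reachable (lineGraph_adj_of_mem (fun h' => h (Subtype.ext h')) hf hg)

/-- Every tree edge has an end off the `x i`, and interior paths between such ends use no `e i`,
since each `e i` contains `x i`. -/
lemma connected_induce_edgesAvoiding [DecidableEq V] (hx : Function.Injective x)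
    (hxe : ∀ i, x i ∈ (e i).1) (hy : ¬ ∃ y, ∀ i, (e i).1 = s(x i, y))
    (hT : IsPendantSteinerTree (Finset.univ.image x) T) :
    (G.lineGraph.induce (edgesAvoiding T e)).Connected := by
  have hcard : 3 ≤ (Finset.univ.image x).card := by simp [Finset.card_image_of_injective _ hx]
  have hinner : ∀ f ∈ edgesAvoiding T e, ∃ v ∈ f.1, v ∈ T.verts ∧ v ∉ Finset.univ.image x := by
    rintro ⟨f, hfG⟩ ⟨hf, -⟩
    induction f with
    | _ u v =>
      have huv : T.Adj u v := hf
      by_cases hu : u ∈ Finset.univ.image x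
      · exact ⟨v, Sym2.mem_mk_right _ _, huv.snd_mem, hT.not_mem_of_adj hcard hu huv⟩
      · exact ⟨u, Sym2.mem_mk_left _ _, huv.fst_mem, hu⟩
  have key : ∀ u v, Relation.ReflTransGen (fun a b => T.Adj a b ∧
      a ∉ Finset.univ.image x ∧ b ∉ Finset.univ.image x) u v →
      ∀ f g : edgesAvoiding T e, u ∈ f.1.1 → v ∈ g.1.1 →
        (G.lineGraph.induce (edgesAvoiding T e)).Reachable f g := by
    intro u v h
    induction h with
    | refl => exact fun f g hf hg => reachable_induce_of_mem f g hf hg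
    | tail _ hab ih =>
      intro f g hf hg
      have hm := edgeOfAdj_mem_edgesAvoiding hxe hab.1 hab.2.1 hab.2.2
      exact (ih f ⟨_, hm⟩ hf (Sym2.mem_mk_left _ _)).trans
        (reachable_induce_of_mem _ g (Sym2.mem_mk_right _ _) hg)
  obtain ⟨f₀, hf₀, -⟩ := exists_mem_edgesAvoiding_adj hx hxe hy hT 0
  refine { preconnected := fun f g => ?_, nonempty := ⟨⟨f₀, hf₀⟩⟩ }
  obtain ⟨u, hu, huT, huS⟩ := hinner f.1 f.2
  obtain ⟨v, hv, hvT, hvS⟩ := hinner g.1 g.2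
  exact key u v (hT.reflTransGen_compl hcard huT hvT huS hvS) f g hu hv

/-- For three edges with distinct representatives whose opposite endpoints do not all coincide,
edge-disjoint pendant trees on the representatives yield internally disjoint pendant trees on
the edges in the line graph. -/
lemma pendantTreeLocalEdgeConnectivity_le_lineGraph [Finite V] [DecidableEq V]
    [DecidableEq G.edgeSet] (hx : Function.Injective x)
    (hxe : ∀ i, x i ∈ (e i).1) (hy : ¬ ∃ y, ∀ i, (e i).1 = s(x i, y)) :
    G.pendantTreeLocalEdgeConnectivity (Finset.univ.image x) ≤
      G.lineGraph.pendantTreeLocalConnectivity (Finset.univ.image e) := by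
  refine csSup_le ⟨0, ∅, by simp⟩ ?_
  rintro m ⟨F, rfl, hF, hd⟩
  rw [← Fintype.card_coe]
  refine card_le_pendantTreeLocalConnectivity (fun T : F => edgesAvoiding T.1 e) ?_
    (fun T => connected_induce_edgesAvoiding hx hxe hy (hF T.1 T.2)) ?_ ?_
  · intro T T' hne
    refine Set.disjoint_left.2 fun f hf hf' => ?_
    have h := hd T.2 T'.2 fun h => hne (Subtype.ext h)
    exact Set.eq_empty_iff_forall_notMem.1 h f.1 ⟨hf.1, hf'.1⟩
  · intro T f hf hfS
    obtain ⟨i, -, hi⟩ := Finset.mem_image.1 hfS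
    exact hf.2 i hi.symm
  · intro T f hf
    obtain ⟨i, -, rfl⟩ := Finset.mem_image.1 hf
    exact exists_mem_edgesAvoiding_adj hx hxe hy (hF T.1 T.2) i

/-- The pendant edges of a pendant `S`-Steiner tree are distinct, so `G` has at least `|S|`
edges. -/
lemma IsPendantSteinerTree.exists_edges {S : Finset V} (hT : IsPendantSteinerTree S T)
    (hS : 3 ≤ S.card) : ∃ S' : Finset G.edgeSet, S'.card = S.card := by
  classical
  choose y hy using fun s : S => hT.exists_adj s.2
  refine ⟨Finset.univ.image fun s : S => edgeOfAdj (hy s), ?_⟩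
  rw [Finset.card_image_of_injective, Finset.card_univ, Fintype.card_coe]
  intro s t hst
  rcases Sym2.eq_iff.1 (congrArg Subtype.val hst) with h | h
  · exact Subtype.ext h.1
  · exact absurd t.2 (h.2 ▸ hT.not_mem_of_adj hS s.2 (hy s))

lemma pendantTreeEdgeConnectivity_le_lineGraph [Finite V] (G : SimpleGraph V) :
    G.pendantTreeEdgeConnectivity 3 ≤ G.lineGraph.pendantTreeConnectivity 3 := by
  classical
  by_cases h : ∃ S' : Finset G.edgeSet, S'.card = 3
  · have hne : {m | ∃ S' : Finset G.edgeSet, S'.card = 3 ∧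
        G.lineGraph.pendantTreeLocalConnectivity S' = m}.Nonempty :=
      let ⟨S', hS'⟩ := h; ⟨_, S', hS', rfl⟩
    obtain ⟨S', hS', hm⟩ := Nat.sInf_mem hne
    rw [pendantTreeConnectivity, ← hm]
    let e : Fin 3 → G.edgeSet := fun i => (S'.equivFinOfCardEq hS').symm i
    have he : Function.Injective e :=
      Subtype.val_injective.comp (S'.equivFinOfCardEq hS').symm.injective
    have himg : Finset.univ.image e = S' := by
      refine Finset.eq_of_subset_of_card_le ?_ ?_
      · intro f hf
        obtain ⟨i, -, rfl⟩ := Finset.mem_image.1 hf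
        exact Subtype.prop _
      · simp [Finset.card_image_of_injective _ he, hS']
    obtain ⟨x, hx, hxe, hy⟩ := exists_representatives e he
    have hle := pendantTreeLocalEdgeConnectivity_le_lineGraph hx hxe hy
    rw [himg] at hle
    refine le_trans (Nat.sInf_le ⟨Finset.univ.image x, ?_, rfl⟩) hle
    simp [Finset.card_image_of_injective _ hx]
  -- With fewer than three edges the right side is the default `0`; the left side vanishes too, as
  -- one pendant tree would already supply three edges.
  · refine le_of_eq_of_le ?_ (Nat.zero_le _)
    by_contra hpos
    have hne := Nat.nonempty_of_pos_sInf (Nat.pos_of_ne_zero hpos)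
    obtain ⟨m, S, hS, hm⟩ := hne
    have hm0 : G.pendantTreeLocalEdgeConnectivity S = 0 := by
      refine Nat.le_zero.1 (csSup_le ⟨0, ∅, by simp⟩ ?_)
      rintro k ⟨F, rfl, hF, -⟩
      refine (Finset.card_eq_zero.2 (Finset.eq_empty_of_forall_notMem fun T hT => h ?_)).le
      exact hS ▸ (hF T hT).exists_edges hS.ge
    exact hpos (Nat.le_zero.1 (Nat.sInf_le ⟨S, hS, hm0⟩))

end LineGraph

end SimpleGraph

theorem mainTheorem1 {V : Type*} [Finite V] (G : SimpleGraph V) (hG : G.Connected) :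
    G.pendantTreeEdgeConnectivity 3 ≤ G.lineGraph.pendantTreeConnectivity 3 ∧
    (1 / 12 : ℝ) * (G.pendantTreeEdgeConnectivity 3 : ℝ) - 1 / 2 ≤
      (G.lineGraph.pendantTreeEdgeConnectivity 3 : ℝ) ∧
    (1 / 4 : ℝ) * (G.pendantTreeConnectivity 3 : ℝ) - 2 / 3 ≤
      (G.lineGraph.lineGraph.pendantTreeConnectivity 3 : ℝ) := by
  have h₁ := G.pendantTreeEdgeConnectivity_le_lineGraph
  have h₂ : G.pendantTreeEdgeConnectivity 3 ≤ G.lineGraph.pendantTreeEdgeConnectivity 3 :=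
    h₁.trans (SimpleGraph.pendantTreeConnectivity_le_edge 3)
  have h₃ : G.pendantTreeConnectivity 3 ≤ G.lineGraph.lineGraph.pendantTreeConnectivity 3 :=
    (SimpleGraph.pendantTreeConnectivity_le_edge 3).trans
      (h₂.trans G.lineGraph.pendantTreeEdgeConnectivity_le_lineGraph)
  refine ⟨h₁, ?_, ?_⟩
  · have : (G.pendantTreeEdgeConnectivity 3 : ℝ) ≤ G.lineGraph.pendantTreeEdgeConnectivity 3 := by
      exact_mod_cast h₂
    have : (0 : ℝ) ≤ G.pendantTreeEdgeConnectivity 3 := Nat.cast_nonneg _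
    linarith
  · have : (G.pendantTreeConnectivity 3 : ℝ) ≤
        G.lineGraph.lineGraph.pendantTreeConnectivity 3 := by exact_mod_cast h₃
    have : (0 : ℝ) ≤ G.pendantTreeConnectivity 3 := Nat.cast_nonneg _
    linarith
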